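/- Let $T=T^*$ be a (possibly unbounded) self-adjoint operator on a complex Hilbert space $\mathcal H$, with spectrum $\sigma(T)$ and resolvent set $\rho(T)=\mathbb C\setminus\sigma(T)$. Let $S=T(\sqrt{I+T^2})^{-1}\in B(\mathcal H)$ be its bounded transform, $C^*(S)\subset B(\mathcal H)$ the $C^*$-algebra generated by $S$ and $I$, $\tilde\sigma(S)=\sigma(S)\cap(-1,1)$, and $u(x)=x/\sqrt{1-x^2}$ for $x\in(-1,1)$; $u$ maps $\tilde\sigma(S)$ homeomorphically onto $\sigma(T)$. For $g\in C_0(\tilde\sigma(S))$ let $g(S)$ be given by the continuous functional calculus of $S$ (with $g$ extended by $0$ to $\sigma(S)$), and for $h\in C_0(\sigma(T))$ put $h(T)=(h\circ u)(S)$. For $\bullet\in\{0,c\}$ let $C^*_\bullet(S)\mathcal H$ be the linear span of the vectors $g(S)\psi$ with $g\in C_\bullet(\tilde\sigma(S))$, $\psi\in\mathcal H$. (i) For every $f\in C(\sigma(T))$ (continuous, complex-valued, possibly unbounded), the formula $f_0(T)h(T)\psi=(fh)(T)\psi$, with $h\in C_c(\sigma(T))$ and $\psi\in\mathcal H$, extends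 linearly to a well-defined, closable operator $f_0(T)$ on the dense domain $C^*_c(S)\mathcal H$. Let $f(T)=f_0(T)^-$ be its closure. If $f$ is bounded, the same formula with $h\in C_0(\sigma(T))$ gives a well-defined closable operator on the dense domain $C^*_0(S)\mathcal H$, and its closure is again $f(T)$. (ii) For every $f\in C(\sigma(T))$ one has $f(T)^*=f^*(T)$, where $f^*(x)=\overline{f(x)}$. In particular, if $f$ is real-valued, then $f(T)$ is self-adjoint, i.e. $f_0(T)^-=f_0(T)^*$. (iii) The map $f\mapsto f(T)$ restricts to an isometric $*$-homomorphism from $C_0(\sigma(T))$ (with supremum norm) to $C^*(S)$, and for $f\in C_0(\sigma(T))$ the operator $f(T)$ defined in (i) coincides with $(f\circ u)(S)$. (iv) $\mathbf 1_{\sigma(T)}(T)=I$, $\mathrm{id}(T)=T$, and $(\mathrm{id}-z)^{-1}(T)=(T-z)^{-1}$ for every $z\in\rho(T)$. -/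

import Mathlib

open scoped ZeroAtInfty CompactlySupported BoundedContinuousFunction

noncomputable section

namespace BoundedTransform

variable {H : Type*} [NormedAddCommGroup H] [InnerProductSpace ℂ H]

/-! ### Unbounded operators -/

/-- The product `AB` of two partially defined operators on its natural domain
`{x ∈ D(B) | B x ∈ D(A)}`. -/
def prod (A B : H →ₗ.[ℂ] H) : H →ₗ.[ℂ] H :=
  A.comp (B.domRestrict ((A.domain.comap B.toFun).map B.domain.subtype)) (by
    rintro ⟨x, hx⟩
    obtain ⟨⟨y, hy, rfl⟩, h2⟩ := hx
    exact hy)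

/-- An everywhere defined bounded operator, seen as a partially defined one. -/
def ofBounded (A : H →L[ℂ] H) : H →ₗ.[ℂ] H := (A : H →ₗ[ℂ] H).toPMap ⊤

open Classical in
/-- The bounded operator given by an everywhere defined bounded partially defined operator `A`
(and `0` if `A` is not of this kind). -/
def toBounded (A : H →ₗ.[ℂ] H) : H →L[ℂ] H :=
  if h : ∃ B : H →L[ℂ] H, ofBounded B = A then h.choose else 0

/-- The operator `T - z` on the domain of `T`. -/
def subScalar (T : H →ₗ.[ℂ] H) (z : ℂ) : H →ₗ.[ℂ] H :=
  (-(z • LinearMap.id : H →ₗ[ℂ] H)) +ᵥ T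

/-- The resolvent set `ρ(T)`: those `z` for which `T - z : D(T) → H` is a bijection. (For closed `T`
the inverse is then automatically bounded, by the closed graph theorem.) -/
def resolvSet (T : H →ₗ.[ℂ] H) : Set ℂ :=
  {z | Function.Bijective (subScalar T z)}

/-- The spectrum `σ(T)`, the complement of the resolvent set. -/
def spec (T : H →ₗ.[ℂ] H) : Set ℂ := (resolvSet T)ᶜ

/-- The operator `I + T²` on the domain `{x ∈ D(T) | T x ∈ D(T)}`. -/
def onePlusSq (T : H →ₗ.[ℂ] H) : H →ₗ.[ℂ] H :=
  (LinearMap.id : H →ₗ[ℂ] H) +ᵥ prod T T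

variable [CompleteSpace H]

/-- The bounded operator `(√(I + T²))⁻¹`, as the positive square root of `(I + T²)⁻¹`. -/
def invSqrt (T : H →ₗ.[ℂ] H) : H →L[ℂ] H :=
  cfc Real.sqrt (toBounded (onePlusSq T).inverse)

/-- The bounded transform `S = T (√(I + T²))⁻¹`. -/
def transform (T : H →ₗ.[ℂ] H) : H →L[ℂ] H :=
  toBounded (prod T (ofBounded (invSqrt T)))

/-! ### Functional calculus of the bounded transform -/

/-- `σ̃(S) = σ(S) ∩ (-1, 1)`. -/
def specTilde (S : H →L[ℂ] H) : Set ℂ :=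
  spectrum ℂ S ∩ (fun x : ℝ => (x : ℂ)) '' Set.Ioo (-1) 1

/-- `g(S)` for a function `g` on `σ̃(S)`: the continuous functional calculus of `S` applied to the
extension of `g` by zero to `σ(S)` (which is continuous if `g ∈ C₀(σ̃(S))`). -/
def calcS (S : H →L[ℂ] H) (g : specTilde S → ℂ) : H →L[ℂ] H :=
  cfc (Function.extend Subtype.val g 0) S

/-- `C*_0(S) H`: the span of the vectors `g(S)ψ` with `g ∈ C₀(σ̃(S))`, `ψ ∈ H`. -/
def c0Range (S : H →L[ℂ] H) : Submodule ℂ H :=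
  Submodule.span ℂ {φ | ∃ (g : C₀(specTilde S, ℂ)) (ψ : H), φ = calcS S g ψ}

/-- `C*_c(S) H`: the span of the vectors `g(S)ψ` with `g ∈ C_c(σ̃(S))`, `ψ ∈ H`. -/
def ccRange (S : H →L[ℂ] H) : Submodule ℂ H :=
  Submodule.span ℂ {φ | ∃ (g : C_c(specTilde S, ℂ)) (ψ : H), φ = calcS S g ψ}

/-! ### Functional calculus of the unbounded operator -/

/-- The function `u(x) = x / √(1 - x²)` on `(-1, 1)`. -/
def u (x : ℝ) : ℝ := x / √(1 - x ^ 2)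

/-- The function `h ∘ u` on `σ̃(S)`, for a function `h` on `σ(T)`; here `u` maps `σ̃(S)` into `σ(T)`,
so that the values of the extension of `h` by zero outside `σ(T)` play no role. -/
def compU (T : H →ₗ.[ℂ] H) (h : spec T → ℂ) : specTilde (transform T) → ℂ :=
  fun μ => Function.extend Subtype.val h 0 ((u (μ : ℂ).re : ℝ) : ℂ)

/-- `h(T) = (h ∘ u)(S)`, for `h ∈ C₀(σ(T))` and in particular for `h ∈ C_c(σ(T))`. -/
def fcZero (T : H →ₗ.[ℂ] H) (h : spec T → ℂ) : H →L[ℂ] H :=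
  calcS (transform T) (compU T h)

/-- `f₀(T)` for `f ∈ C(σ(T))`: the linear extension of `h(T)ψ ↦ (f h)(T)ψ`, with `h ∈ C_c(σ(T))`
and `ψ ∈ H`, given by its graph. -/
def fcPre (T : H →ₗ.[ℂ] H) (f : C(spec T, ℂ)) : H →ₗ.[ℂ] H :=
  (Submodule.span ℂ {p : H × H | ∃ (h : C_c(spec T, ℂ)) (ψ : H),
    p = (fcZero T h ψ, fcZero T (f * h) ψ)}).toLinearPMap

/-- `f₀(T)` for bounded `f`, on the larger domain `C*_0(S) H`: the linear extension of
`h(T)ψ ↦ (f h)(T)ψ`, with `h ∈ C₀(σ(T))` and `ψ ∈ H`, given by its graph. -/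
def fcPreBounded (T : H →ₗ.[ℂ] H) (f : spec T →ᵇ ℂ) : H →ₗ.[ℂ] H :=
  (Submodule.span ℂ {p : H × H | ∃ (h : C₀(spec T, ℂ)) (ψ : H),
    p = (fcZero T h ψ, fcZero T (f * h) ψ)}).toLinearPMap

/-- `f(T)` for `f ∈ C(σ(T))`: the closure of `f₀(T)`. -/
def fc (T : H →ₗ.[ℂ] H) (f : C(spec T, ℂ)) : H →ₗ.[ℂ] H := (fcPre T f).closure

/-- The identity function on `σ(T)`. -/
def idFun (T : H →ₗ.[ℂ] H) : C(spec T, ℂ) := ⟨fun x => (x : ℂ), continuous_subtype_val⟩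

/-- The function `x ↦ (x - z)⁻¹` on `σ(T)`, for `z ∈ ρ(T)`. -/
def resolventFun (T : H →ₗ.[ℂ] H) (z : ℂ) (hz : z ∈ resolvSet T) : C(spec T, ℂ) :=
  ⟨fun x => ((x : ℂ) - z)⁻¹, (continuous_subtype_val.sub continuous_const).inv₀
    fun x hx => x.2 (by rwa [sub_eq_zero.mp hx])⟩

end BoundedTransform

end

open BoundedTransform

noncomputable section

namespace BoundedTransform

open scoped InnerProductSpace
open Filter Topology

variable {H : Type*} [NormedAddCommGroup H] [InnerProductSpace ℂ H]

/-! ### Graphs of the basic constructions -/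

/-! Operators are compared through their graphs. Write `B` for `invSqrt T` and `S` for `transform
T`. Orthogonal projection onto the closed graph of `T` produces `(1 + T²)⁻¹` and `T (1 + T²)⁻¹`.
From these one gets `B² + S² = 1`, so `B = √(1 - S²)`, and the graph of `T` is exactly the set of
pairs `(B w, S w)`. Hence `T - z` is `S - z B` composed with `B⁻¹`. Since `S - z B` is a continuous
function of `S`, spectral mapping gives `σ(T) = u(σ̃(S))`, and the `C₀`-calculus of `T` is that of
`S` with functions extended by zero.

For general `f` the central object is `calcGraph T f`, the closed relation `h(T) y = (f h)(T) x` for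
all `h ∈ C_c`. Compactly supported cutoffs `eₙ` satisfy `eₙ(T) → 1` strongly
(`tendsto_fcZero_cutoff`). Therefore this relation is single-valued, each subspace of it containing
the generators `(h(T)ψ, (f h)(T)ψ)` is dense in it, and the adjoint of an operator with such a graph
has graph `calcGraph T (star f)`. Closability, the agreement of the two domains after closure, the
adjoint formula and the special cases then reduce to identities between functions on the spectrum.
-/

theorem mem_graph_prod {A B : H →ₗ.[ℂ] H} {x z : H} :
    (x, z) ∈ (prod A B).graph ↔ ∃ y, (x, y) ∈ B.graph ∧ (y, z) ∈ A.graph := by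
  constructor
  · intro h
    obtain ⟨⟨a, ha⟩, rfl, rfl⟩ := LinearPMap.mem_graph_iff _ |>.1 h
    obtain ⟨⟨⟨b, hb⟩, hbA, rfl⟩, ha2⟩ := id ha
    exact ⟨B ⟨b, hb⟩, B.mem_graph ⟨b, hb⟩, A.mem_graph ⟨B ⟨b, hb⟩, hbA⟩⟩
  · rintro ⟨y, hxy, hyz⟩
    obtain ⟨⟨a, ha⟩, rfl, rfl⟩ := LinearPMap.mem_graph_iff _ |>.1 hxy
    obtain ⟨⟨b, hb⟩, hb1, rfl⟩ := LinearPMap.mem_graph_iff _ |>.1 hyz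
    simp only at hb1
    subst hb1
    have hmem : a ∈ (prod A B).domain := ⟨⟨⟨a, ha⟩, hb, rfl⟩, ha⟩
    exact (LinearPMap.mem_graph_iff _).2 ⟨⟨a, hmem⟩, rfl, rfl⟩

theorem mem_graph_ofBounded {A : H →L[ℂ] H} {x y : H} :
    (x, y) ∈ (ofBounded A).graph ↔ A x = y := by
  constructor
  · intro h
    obtain ⟨⟨a, ha⟩, rfl, rfl⟩ := LinearPMap.mem_graph_iff _ |>.1 h
    rfl
  · rintro rfl
    exact (LinearPMap.mem_graph_iff _).2 ⟨⟨x, trivial⟩, rfl, rfl⟩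

theorem mem_graph_vadd {L : H →ₗ[ℂ] H} {A : H →ₗ.[ℂ] H} {x z : H} :
    (x, z) ∈ (L +ᵥ A).graph ↔ (x, z - L x) ∈ A.graph := by
  constructor
  · intro h
    obtain ⟨⟨a, ha⟩, rfl, rfl⟩ := LinearPMap.mem_graph_iff _ |>.1 h
    rw [LinearPMap.vadd_apply, add_sub_cancel_left]
    exact A.mem_graph ⟨a, ha⟩
  · intro h
    obtain ⟨⟨a, ha⟩, rfl, h2⟩ := LinearPMap.mem_graph_iff _ |>.1 h
    refine (LinearPMap.mem_graph_iff _).2 ⟨⟨a, ha⟩, rfl, ?_⟩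
    rw [LinearPMap.vadd_apply]
    exact (eq_sub_iff_add_eq'.1 h2)

theorem mem_graph_onePlusSq {T : H →ₗ.[ℂ] H} {x z : H} :
    (x, z) ∈ (onePlusSq T).graph ↔ ∃ y, (x, y) ∈ T.graph ∧ (y, z - x) ∈ T.graph := by
  rw [onePlusSq, mem_graph_vadd, mem_graph_prod]
  rfl

theorem mem_graph_subScalar {T : H →ₗ.[ℂ] H} {c : ℂ} {x z : H} :
    (x, z) ∈ (subScalar T c).graph ↔ (x, z + c • x) ∈ T.graph := by
  rw [subScalar, mem_graph_vadd]
  simp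

theorem mem_graph_inverse {A : H →ₗ.[ℂ] H} (hA : ∀ x, (x, 0) ∈ A.graph → x = 0) {x y : H} :
    (x, y) ∈ A.inverse.graph ↔ (y, x) ∈ A.graph := by
  rw [LinearPMap.inverse_graph]
  · simp
  · rw [LinearMap.ker_eq_bot']
    intro m hm
    have := A.mem_graph m
    rw [show A m = 0 from hm] at this
    exact Subtype.ext (hA _ this)

theorem ofBounded_injective : Function.Injective (ofBounded : (H →L[ℂ] H) → H →ₗ.[ℂ] H) := by
  intro A B h
  ext x
  have : (x, B x) ∈ (ofBounded A).graph := h ▸ mem_graph_ofBounded.2 rfl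
  exact mem_graph_ofBounded.1 this

theorem toBounded_ofBounded (A : H →L[ℂ] H) : toBounded (ofBounded A) = A := by
  have h : ∃ B : H →L[ℂ] H, ofBounded B = ofBounded A := ⟨A, rfl⟩
  rw [toBounded, dif_pos h]
  exact ofBounded_injective h.choose_spec

theorem eq_ofBounded {A : H →ₗ.[ℂ] H} {B : H →L[ℂ] H} (h : ∀ x, (x, B x) ∈ A.graph) :
    A = ofBounded B := by
  symm
  apply LinearPMap.eq_of_eq_graph
  ext ⟨x, y⟩
  rw [mem_graph_ofBounded]
  constructor
  · rintro rfl
    exact h x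
  · exact fun hy => LinearPMap.mem_graph_snd_inj A (h x) hy rfl

variable [CompleteSpace H]

/-! ### The bounded transform of a self-adjoint operator -/

section SelfAdjoint

variable {T : H →ₗ.[ℂ] H}

theorem mem_graph_iff_of_isSelfAdjoint (hT : IsSelfAdjoint T) {v w : H} :
    (v, w) ∈ T.graph ↔ ∀ a b, (a, b) ∈ T.graph → ⟪b, v⟫_ℂ = ⟪a, w⟫_ℂ := by
  conv_lhs => rw [← LinearPMap.isSelfAdjoint_def.1 hT,
    LinearPMap.adjoint_graph_eq_graph_adjoint hT.dense_domain]
  simp [sub_eq_zero]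

theorem inner_graph_comm (hT : IsSelfAdjoint T) {a b v w : H} (h : (a, b) ∈ T.graph)
    (h' : (v, w) ∈ T.graph) : ⟪b, v⟫_ℂ = ⟪a, w⟫_ℂ :=
  (mem_graph_iff_of_isSelfAdjoint hT).1 h' a b h

/-- Symmetry of `T` gives `‖y‖² = -‖x‖²`. This is the injectivity of `1 + T²`. -/
theorem eq_zero_of_onePlusSq (hT : IsSelfAdjoint T) {x y : H} (h : (x, y) ∈ T.graph)
    (h' : (y, -x) ∈ T.graph) : x = 0 := by
  have := inner_graph_comm hT h h'
  rw [inner_neg_right, inner_self_eq_norm_sq_to_K, inner_self_eq_norm_sq_to_K] at this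
  have h2 : ‖y‖ ^ 2 = -‖x‖ ^ 2 := by exact_mod_cast this
  have : ‖x‖ = 0 := by nlinarith [sq_nonneg ‖x‖, sq_nonneg ‖y‖]
  simpa using this

/-- The bounded operators `A = (1 + T²)⁻¹` and `C = T (1 + T²)⁻¹`, obtained from the orthogonal
projection onto the graph of `T`. -/
theorem exists_onePlusSq_inverse (hT : IsSelfAdjoint T) : ∃ A C : H →L[ℂ] H,
    ∀ x, (A x, C x) ∈ T.graph ∧ (C x, x - A x) ∈ T.graph := by
  -- `H × H` carries the sup norm; the projection needs the Hilbert space structure of `WithLp 2`.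
  let e : WithLp 2 (H × H) ≃L[ℂ] H × H := WithLp.prodContinuousLinearEquiv 2 ℂ H H
  let K : Submodule ℂ (WithLp 2 (H × H)) := T.graph.comap e.toLinearEquiv.toLinearMap
  have hK : IsClosed (K : Set (WithLp 2 (H × H))) :=
    IsClosed.preimage e.continuous hT.isClosed
  have : CompleteSpace K := hK.completeSpace_coe
  let P : H →L[ℂ] H × H := (e : WithLp 2 (H × H) →L[ℂ] H × H) ∘L K.starProjection ∘L
    (e.symm : H × H →L[ℂ] WithLp 2 (H × H)) ∘L ContinuousLinearMap.inl ℂ H H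
  refine ⟨ContinuousLinearMap.fst ℂ H H ∘L P, ContinuousLinearMap.snd ℂ H H ∘L P, fun x => ?_⟩
  have h1 : P x ∈ T.graph := K.starProjection_apply_mem (e.symm (x, 0))
  refine ⟨h1, ?_⟩
  rw [mem_graph_iff_of_isSelfAdjoint hT]
  intro a b hab
  -- The residual `(x - A x, -C x)` is orthogonal to the graph of `T`, which for `T = T*` says that
  -- `(C x, x - A x)` lies in the graph.
  have h2 := K.sub_starProjection_mem_orthogonal (e.symm (x, 0))
  have h3 := (Submodule.mem_orthogonal _ _).1 h2 (e.symm (a, b)) (by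
    change e (e.symm (a, b)) ∈ T.graph
    simpa using hab)
  rw [WithLp.prod_inner_apply] at h3
  change ⟪a, x - (P x).1⟫_ℂ + ⟪b, 0 - (P x).2⟫_ℂ = 0 at h3
  rw [zero_sub, inner_neg_right] at h3
  change ⟪b, (P x).2⟫_ℂ = ⟪a, x - (P x).1⟫_ℂ
  rw [← sub_eq_zero, ← neg_eq_zero, ← h3]
  ring

section

variable {A C : H →L[ℂ] H} (hAC : ∀ x, (A x, C x) ∈ T.graph ∧ (C x, x - A x) ∈ T.graph)
  (hT : IsSelfAdjoint T)
include hAC hT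

theorem eq_onePlusSq_inverse_apply {x a b : H} (h : (a, b) ∈ T.graph)
    (h' : (b, x - a) ∈ T.graph) : A x = a ∧ C x = b := by
  have h1 : A x = a := by
    rw [← sub_eq_zero]
    refine eq_zero_of_onePlusSq hT (y := C x - b) (T.graph.sub_mem (hAC x).1 h) ?_
    convert! T.graph.sub_mem (hAC x).2 h' using 1
    ext <;> simp
  exact ⟨h1, LinearPMap.mem_graph_snd_inj T (hAC x).1 h h1⟩

theorem inverse_onePlusSq : (onePlusSq T).inverse = ofBounded A := by
  refine eq_ofBounded fun x => ?_
  rw [mem_graph_inverse]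
  · exact mem_graph_onePlusSq.2 ⟨C x, hAC x⟩
  · intro y hy
    obtain ⟨z, h1, h2⟩ := mem_graph_onePlusSq.1 hy
    exact eq_zero_of_onePlusSq hT h1 (by simpa using h2)

theorem toBounded_inverse_onePlusSq : toBounded (onePlusSq T).inverse = A := by
  rw [inverse_onePlusSq hAC hT, toBounded_ofBounded]

/-- Split `y = A y + (y - A y)` and move `T` across the second term. This identity yields positivity
of `A` and, later, the bound `‖C x‖ ≤ ‖B x‖`. -/
theorem inner_onePlusSq_inverse (x y : H) :
    ⟪A x, y⟫_ℂ = ⟪A x, A y⟫_ℂ + ⟪C x, C y⟫_ℂ := by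
  rw [inner_graph_comm hT (hAC x).1 (hAC y).2, ← inner_add_right, add_sub_cancel]

theorem onePlusSq_inverse_nonneg : 0 ≤ A := by
  have key : ∀ x y, ⟪x, A y⟫_ℂ = ⟪A x, y⟫_ℂ := fun x y => by
    rw [inner_onePlusSq_inverse hAC hT x y, ← inner_conj_symm x (A y),
      inner_onePlusSq_inverse hAC hT y x]
    simp
  rw [ContinuousLinearMap.nonneg_iff_isPositive, ContinuousLinearMap.isPositive_def]
  refine ⟨fun x y => (key x y).symm, fun x => ?_⟩
  rw [ContinuousLinearMap.reApplyInnerSelf, inner_onePlusSq_inverse hAC hT, map_add,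
    inner_self_eq_norm_sq, inner_self_eq_norm_sq]
  positivity

theorem isSelfAdjoint_mul_onePlusSq_inverse : IsSelfAdjoint C := by
  rw [ContinuousLinearMap.isSelfAdjoint_iff_isSymmetric]
  intro x y
  change ⟪C x, y⟫_ℂ = ⟪x, C y⟫_ℂ
  have h1 : ⟪C x, y⟫_ℂ = ⟪C x, A y⟫_ℂ + ⟪x - A x, C y⟫_ℂ := by
    rw [inner_graph_comm hT (hAC x).2 (hAC y).2, ← inner_add_right, add_sub_cancel]
  rw [h1, inner_graph_comm hT (hAC x).1 (hAC y).1, ← inner_add_left, add_sub_cancel]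

theorem commute_onePlusSq_inverse : Commute A C := by
  ext x
  refine (eq_onePlusSq_inverse_apply hAC hT (x := C x) (a := C (A x)) (b := A x - A (A x)) ?_ ?_).1
  · exact (hAC (A x)).2
  · convert! T.graph.sub_mem (hAC x).1 (hAC (A x)).1 using 1

/-- Formally `(1 + T²)⁻¹ (x + T (T x)) = x`, but valid on all of `D(T)`: the pair `(x - C y, A y)`
solves the equations characterizing `(A x, C x)`. -/
theorem onePlusSq_inverse_add_apply {x y : H} (h : (x, y) ∈ T.graph) : A x + C y = x := by
  have h1 := (eq_onePlusSq_inverse_apply hAC hT (x := x) (a := x - C y) (b := A y) ?_ ?_).1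
  · rw [h1, sub_add_cancel]
  · convert! T.graph.sub_mem h (hAC y).2 using 1
    ext <;> simp
  · convert! (hAC y).1 using 1
    ext <;> simp

end

/-- `invSqrt T * invSqrt T = (1 + T²)⁻¹`. -/
theorem invSqrt_mul_invSqrt {A C : H →L[ℂ] H}
    (hAC : ∀ x, (A x, C x) ∈ T.graph ∧ (C x, x - A x) ∈ T.graph) (hT : IsSelfAdjoint T) :
    invSqrt T * invSqrt T = A := by
  have hA : IsSelfAdjoint A := (onePlusSq_inverse_nonneg hAC hT).isSelfAdjoint
  rw [invSqrt, toBounded_inverse_onePlusSq hAC hT, ← cfc_mul ..]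
  conv_rhs => rw [← cfc_id ℝ A]
  refine cfc_congr fun x hx => ?_
  exact Real.mul_self_sqrt (spectrum_nonneg_of_nonneg (onePlusSq_inverse_nonneg hAC hT) hx)

theorem isSelfAdjoint_invSqrt : IsSelfAdjoint (invSqrt T) := IsSelfAdjoint.cfc

theorem invSqrt_injective (hT : IsSelfAdjoint T) : Function.Injective (invSqrt T) := by
  obtain ⟨A, C, hAC⟩ := exists_onePlusSq_inverse hT
  rw [injective_iff_map_eq_zero]
  intro x hx
  have hA : A x = 0 := by
    rw [← invSqrt_mul_invSqrt hAC hT, mul_apply_eq_comp, hx, map_zero]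
  have h2 := LinearPMap.mem_graph_snd_inj T (hAC x).1 T.graph.zero_mem hA
  have h3 := LinearPMap.mem_graph_snd_inj T (hAC x).2 T.graph.zero_mem h2
  simpa [hA] using h3

theorem denseRange_invSqrt (hT : IsSelfAdjoint T) : DenseRange (invSqrt T) := by
  have h : (LinearMap.range (invSqrt T : H →ₗ[ℂ] H))ᗮ = ⊥ := by
    rw [Submodule.eq_bot_iff]
    intro x hx
    apply invSqrt_injective hT
    rw [map_zero]
    refine ext_inner_left ℂ fun v => ?_
    rw [inner_zero_right]
    have := (Submodule.mem_orthogonal _ _).1 hx (invSqrt T v) ⟨v, rfl⟩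
    rwa [← ContinuousLinearMap.adjoint_inner_right,
      (isSelfAdjoint_invSqrt (T := T)).adjoint_eq] at this
  rw [← Submodule.topologicalClosure_eq_top_iff] at h
  have h2 := Submodule.dense_iff_topologicalClosure_eq_top.2 h
  rwa [LinearMap.coe_range] at h2

/-- Because `‖C x‖ ≤ ‖B x‖` and `B` has dense range, `B x ↦ C x` extends to a bounded `S`. The pair
`(B x, S x)` is in the graph for `x` in the range of `B`, hence for all `x` as the graph is closed.
-/
theorem exists_transform (hT : IsSelfAdjoint T) : ∃ S : H →L[ℂ] H,
    ∀ x, (invSqrt T x, S x) ∈ T.graph := by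
  obtain ⟨A, C, hAC⟩ := exists_onePlusSq_inverse hT
  have hB := invSqrt_mul_invSqrt hAC hT
  have hd := denseRange_invSqrt hT
  have hn : ∀ x, ‖C x‖ ≤ 1 * ‖invSqrt T x‖ := by
    intro x
    have h1 := inner_onePlusSq_inverse hAC hT x x
    rw [← hB, mul_apply_eq_comp, ← ContinuousLinearMap.adjoint_inner_right,
      (isSelfAdjoint_invSqrt (T := T)).adjoint_eq, inner_self_eq_norm_sq_to_K,
      inner_self_eq_norm_sq_to_K, inner_self_eq_norm_sq_to_K] at h1
    have h2 : ‖invSqrt T x‖ ^ 2 = ‖invSqrt T (invSqrt T x)‖ ^ 2 + ‖C x‖ ^ 2 := by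
      exact_mod_cast h1
    rw [one_mul]
    refine le_of_sq_le_sq ?_ (norm_nonneg _)
    nlinarith [sq_nonneg ‖invSqrt T (invSqrt T x)‖]
  let S : H →L[ℂ] H := (C : H →ₗ[ℂ] H).extendOfNorm (invSqrt T : H →ₗ[ℂ] H)
  have hS : ∀ x, S (invSqrt T x) = C x := fun x =>
    LinearMap.extendOfNorm_eq (f := (C : H →ₗ[ℂ] H)) (e := (invSqrt T : H →ₗ[ℂ] H)) hd ⟨1, hn⟩ x
  refine ⟨S, fun x => ?_⟩
  refine hd.induction_on (p := fun x => (invSqrt T x, S x) ∈ T.graph) x ?_ ?_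
  · exact hT.isClosed.preimage ((invSqrt T).continuous.prodMk S.continuous)
  · intro y
    rw [hS, ← mul_apply_eq_comp, hB]
    exact (hAC y).1

theorem transform_mem_graph (hT : IsSelfAdjoint T) (x : H) :
    (invSqrt T x, transform T x) ∈ T.graph := by
  obtain ⟨S, hS⟩ := exists_transform hT
  have : transform T = S := by
    rw [transform, eq_ofBounded (A := prod T _) (B := S), toBounded_ofBounded]
    exact fun x => mem_graph_prod.2 ⟨_, mem_graph_ofBounded.2 rfl, hS x⟩
  rw [this]
  exact hS x

theorem transform_mul_invSqrt {A C : H →L[ℂ] H}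
    (hAC : ∀ x, (A x, C x) ∈ T.graph ∧ (C x, x - A x) ∈ T.graph) (hT : IsSelfAdjoint T) :
    transform T * invSqrt T = C := by
  ext x
  refine LinearPMap.mem_graph_snd_inj T (transform_mem_graph hT (invSqrt T x)) (hAC x).1 ?_
  rw [← invSqrt_mul_invSqrt hAC hT, mul_apply_eq_comp]

theorem transform_commute_invSqrt (hT : IsSelfAdjoint T) :
    Commute (transform T) (invSqrt T) := by
  obtain ⟨A, C, hAC⟩ := exists_onePlusSq_inverse hT
  have hCB : Commute (invSqrt T) C := by
    rw [invSqrt, toBounded_inverse_onePlusSq hAC hT]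
    exact (commute_onePlusSq_inverse hAC hT).cfc_real _
  have hSB := transform_mul_invSqrt hAC hT
  ext x
  refine (denseRange_invSqrt hT).induction_on
    (p := fun x => (transform T * invSqrt T) x = (invSqrt T * transform T) x) x ?_ ?_
  · exact isClosed_eq (ContinuousLinearMap.continuous _) (ContinuousLinearMap.continuous _)
  · intro y
    have := congr($hCB y)
    simp only [mul_apply_eq_comp] at this ⊢
    rw [← hSB] at this
    simpa using this.symm

/-- Since `S B = C` is self-adjoint and `S` commutes with `B`, one has `B S* = B S`; cancel the
injective `B`. -/
theorem isSelfAdjoint_transform (hT : IsSelfAdjoint T) : IsSelfAdjoint (transform T) := by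
  obtain ⟨A, C, hAC⟩ := exists_onePlusSq_inverse hT
  have hSB := transform_mul_invSqrt hAC hT
  have hB : star (invSqrt T) = invSqrt T := isSelfAdjoint_invSqrt
  have h1 : invSqrt T * star (transform T) = invSqrt T * transform T := by
    rw [← (transform_commute_invSqrt hT).eq, hSB,
      ← (isSelfAdjoint_mul_onePlusSq_inverse hAC hT).star_eq, ← hSB, star_mul, hB]
  ext x
  exact invSqrt_injective hT congr($h1 x)

theorem mem_graph_iff_transform (hT : IsSelfAdjoint T) {x y : H} :
    (x, y) ∈ T.graph ↔ ∃ w, invSqrt T w = x ∧ transform T w = y := by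
  constructor
  · intro h
    obtain ⟨A, C, hAC⟩ := exists_onePlusSq_inverse hT
    -- The witness is forced: `w = (B² + S²) w = B x + S y` when `x = B w` and `y = S w`.
    have h1 : invSqrt T (invSqrt T x + transform T y) = x := by
      have h2 := onePlusSq_inverse_add_apply hAC hT h
      rw [← invSqrt_mul_invSqrt hAC hT, ← transform_mul_invSqrt hAC hT,
        (transform_commute_invSqrt hT).eq] at h2
      simpa using h2
    exact ⟨_, h1, LinearPMap.mem_graph_snd_inj T (transform_mem_graph hT _) h h1⟩
  · rintro ⟨w, rfl, rfl⟩
    exact transform_mem_graph hT w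

theorem invSqrt_sq_add_transform_sq (hT : IsSelfAdjoint T) :
    invSqrt T * invSqrt T + transform T * transform T = 1 := by
  obtain ⟨A, C, hAC⟩ := exists_onePlusSq_inverse hT
  ext x
  apply invSqrt_injective hT
  have h := onePlusSq_inverse_add_apply hAC hT (transform_mem_graph hT x)
  rw [← invSqrt_mul_invSqrt hAC hT, ← transform_mul_invSqrt hAC hT,
    (transform_commute_invSqrt hT).eq] at h
  simpa using h

/-- `(√(1 + T²))⁻¹ = √(1 - S²)`. -/
theorem invSqrt_eq_cfc (hT : IsSelfAdjoint T) :
    invSqrt T = cfc (fun s : ℂ => ((√(1 - s.re ^ 2) : ℝ) : ℂ)) (transform T) := by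
  have hS := isSelfAdjoint_transform hT
  obtain ⟨A, C, hAC⟩ := exists_onePlusSq_inverse hT
  have hA : A = cfc (fun s : ℝ => 1 - s ^ 2) (transform T) := by
    rw [cfc_sub .., cfc_pow .., cfc_const_one .., cfc_id' .., ← invSqrt_sq_add_transform_sq hT,
      ← invSqrt_mul_invSqrt hAC hT, pow_two, add_sub_cancel_right]
  rw [← cfc_real_eq_complex (fun s : ℝ => √(1 - s ^ 2)) hS, cfc_comp' Real.sqrt _ _, ← hA,
    invSqrt, toBounded_inverse_onePlusSq hAC hT]

end SelfAdjoint

/-! ### The spectrum of `T` and the spectrum of its bounded transform -/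

theorem one_sub_sq_pos {x : ℝ} (hx : x ∈ Set.Ioo (-1 : ℝ) 1) : 0 < 1 - x ^ 2 := by
  nlinarith [hx.1, hx.2]

/-- Either equation forces `√(1 + y²) √(1 - x²) = 1`, which turns it into the other. -/
theorem u_eq_iff {x y : ℝ} (hx : x ∈ Set.Ioo (-1 : ℝ) 1) : u x = y ↔ x = y / √(1 + y ^ 2) := by
  have h0 := one_sub_sq_pos hx
  have h1 : 0 < √(1 - x ^ 2) := Real.sqrt_pos.2 h0
  have h2 : 0 < √(1 + y ^ 2) := Real.sqrt_pos.2 (by positivity)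
  have s1 := Real.sq_sqrt h0.le
  have s2 := Real.sq_sqrt (show 0 ≤ 1 + y ^ 2 by positivity)
  rw [u, div_eq_iff h1.ne', eq_div_iff h2.ne']
  constructor
  · intro h
    have : √(1 + y ^ 2) * √(1 - x ^ 2) = 1 := by
      rw [← Real.sqrt_mul (by positivity), Real.sqrt_eq_one]
      have : x ^ 2 = y ^ 2 * (1 - x ^ 2) := by
        rw [← s1, ← mul_pow, ← h]
      linarith
    calc x * √(1 + y ^ 2) = y * (√(1 + y ^ 2) * √(1 - x ^ 2)) := by
          linear_combination √(1 + y ^ 2) * h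
      _ = y := by rw [this, mul_one]
  · intro h
    have : √(1 + y ^ 2) * √(1 - x ^ 2) = 1 := by
      rw [← Real.sqrt_mul (by positivity), Real.sqrt_eq_one]
      have : y ^ 2 = x ^ 2 * (1 + y ^ 2) := by
        rw [← s2, ← mul_pow, h]
      linarith
    calc x = x * (√(1 + y ^ 2) * √(1 - x ^ 2)) := by rw [this, mul_one]
      _ = y * √(1 - x ^ 2) := by linear_combination √(1 - x ^ 2) * h

omit [CompleteSpace H] in
theorem mem_specTilde_iff {S : H →L[ℂ] H} {s : ℂ} :
    s ∈ specTilde S ↔ s ∈ spectrum ℂ S ∧ (s.re : ℂ) = s ∧ s.re ∈ Set.Ioo (-1 : ℝ) 1 := by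
  constructor
  · rintro ⟨h, x, hx, rfl⟩
    exact ⟨h, by simp, by simpa using hx⟩
  · rintro ⟨h, h1, h2⟩
    exact ⟨h, s.re, h2, h1⟩

variable {T : H →ₗ.[ℂ] H}

theorem transform_sub_smul_invSqrt_eq_cfc (hT : IsSelfAdjoint T) (z : ℂ) :
    transform T - z • invSqrt T =
      cfc (fun s : ℂ => s - z * ((√(1 - s.re ^ 2) : ℝ) : ℂ)) (transform T) := by
  have : IsStarNormal (transform T) := (isSelfAdjoint_transform hT).isStarNormal
  rw [cfc_sub .., cfc_id' .., cfc_const_mul .., ← invSqrt_eq_cfc hT]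

theorem mem_graph_subScalar_iff_transform (hT : IsSelfAdjoint T) {c : ℂ} {v w : H} :
    (v, w) ∈ (subScalar T c).graph ↔
      ∃ a, invSqrt T a = v ∧ (transform T - c • invSqrt T) a = w := by
  rw [mem_graph_subScalar, mem_graph_iff_transform hT]
  refine exists_congr fun a => and_congr_right fun h => ?_
  subst h
  simp [sub_eq_iff_eq_add]

/-- `B` is a bijection of `H` onto `D(T)` carrying `T - z` to `S - z B`. -/
theorem mem_resolvSet_iff_isUnit (hT : IsSelfAdjoint T) {z : ℂ} :
    z ∈ resolvSet T ↔ IsUnit (transform T - z • invSqrt T) := by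
  rw [ContinuousLinearMap.isUnit_iff_bijective]
  have key : ∀ a, ∃ x : (subScalar T z).domain, (x : H) = invSqrt T a ∧
      subScalar T z x = (transform T - z • invSqrt T) a := fun a =>
    (LinearPMap.mem_graph_iff _).1 ((mem_graph_subScalar_iff_transform hT).2 ⟨a, rfl, rfl⟩)
  have key' : ∀ x : (subScalar T z).domain, ∃ a, invSqrt T a = x ∧
      (transform T - z • invSqrt T) a = subScalar T z x := fun x =>
    (mem_graph_subScalar_iff_transform hT).1 (LinearPMap.mem_graph _ x)
  constructor
  · rintro ⟨hi, hs⟩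
    refine ⟨fun a b hab => ?_, fun y => ?_⟩
    · obtain ⟨x, hx, hx'⟩ := key a
      obtain ⟨y, hy, hy'⟩ := key b
      have : x = y := hi (by rw [hx', hy', hab])
      exact invSqrt_injective hT (by rw [← hx, ← hy, this])
    · obtain ⟨x, rfl⟩ := hs y
      obtain ⟨a, -, ha⟩ := key' x
      exact ⟨a, ha⟩
  · rintro ⟨hi, hs⟩
    refine ⟨fun x y hxy => ?_, fun y => ?_⟩
    · obtain ⟨a, ha, ha'⟩ := key' x
      obtain ⟨b, hb, hb'⟩ := key' y
      have : a = b := hi (by rw [ha', hb', hxy])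
      exact Subtype.ext (by rw [← ha, ← hb, this])
    · obtain ⟨a, rfl⟩ := hs y
      obtain ⟨x, -, hx⟩ := key a
      exact ⟨x, hx⟩

theorem mem_spec_iff (hT : IsSelfAdjoint T) {z : ℂ} :
    z ∈ spec T ↔ ∃ s ∈ specTilde (transform T), ((u s.re : ℝ) : ℂ) = z := by
  have hS := isSelfAdjoint_transform hT
  have : IsStarNormal (transform T) := hS.isStarNormal
  rw [spec, Set.mem_compl_iff, mem_resolvSet_iff_isUnit hT, transform_sub_smul_invSqrt_eq_cfc hT,
    isUnit_cfc_iff ..]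
  push Not
  constructor
  · rintro ⟨s, hs, h⟩
    have hre : (s.re : ℂ) = s := (hS.mem_spectrum_eq_re hs).symm
    rcases le_or_gt (1 - s.re ^ 2) 0 with h1 | h1
    · rw [Real.sqrt_eq_zero_of_nonpos h1] at h
      have : s = 0 := by simpa using h
      simp [this] at h1
      linarith
    · refine ⟨s, mem_specTilde_iff.2 ⟨hs, hre, abs_lt.1 ?_⟩, ?_⟩
      · rw [← sq_lt_one_iff_abs_lt_one]
        linarith
      · have h2 : ((√(1 - s.re ^ 2) : ℝ) : ℂ) ≠ 0 := by
          exact_mod_cast (Real.sqrt_pos.2 h1).ne'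
        rw [u, Complex.ofReal_div, hre, div_eq_iff h2]
        exact sub_eq_zero.1 h
  · rintro ⟨s, hs, rfl⟩
    obtain ⟨h1, h2, h3⟩ := mem_specTilde_iff.1 hs
    refine ⟨s, h1, ?_⟩
    have h4 : √(1 - s.re ^ 2) ≠ 0 := (Real.sqrt_pos.2 (one_sub_sq_pos h3)).ne'
    rw [← Complex.ofReal_mul, u, div_mul_cancel₀ _ h4, h2, sub_self]

theorem isClosed_spec (hT : IsSelfAdjoint T) : IsClosed (spec T) := by
  have : resolvSet T = (fun z : ℂ => transform T - z • invSqrt T) ⁻¹' {A | IsUnit A} := by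
    ext z
    exact mem_resolvSet_iff_isUnit hT
  rw [spec, isClosed_compl_iff, this]
  exact Units.isOpen.preimage (by fun_prop)

/-- The homeomorphism `u : σ̃(S) → σ(T)`. -/
def specHomeo (hT : IsSelfAdjoint T) : specTilde (transform T) ≃ₜ spec T where
  toFun s := ⟨(u (s : ℂ).re : ℝ), (mem_spec_iff hT).2 ⟨s, s.2, rfl⟩⟩
  invFun x := ⟨(((x : ℂ).re / √(1 + (x : ℂ).re ^ 2) : ℝ) : ℂ), by
    obtain ⟨s, hs, h⟩ := (mem_spec_iff hT).1 x.2
    obtain ⟨-, h2, h3⟩ := mem_specTilde_iff.1 hs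
    rw [← (u_eq_iff h3).1 (by rw [← h, Complex.ofReal_re]), h2]
    exact hs⟩
  left_inv s := by
    obtain ⟨-, h2, h3⟩ := mem_specTilde_iff.1 s.2
    ext
    simp only [Complex.ofReal_re]
    rw [← (u_eq_iff h3).1 rfl, h2]
  right_inv x := by
    obtain ⟨s, hs, h⟩ := (mem_spec_iff hT).1 x.2
    obtain ⟨-, h2, h3⟩ := mem_specTilde_iff.1 hs
    ext
    simp only [Complex.ofReal_re]
    rw [← (u_eq_iff h3).1 (by rw [← h, Complex.ofReal_re]), h]
  continuous_toFun := by
    refine Continuous.subtype_mk (Complex.continuous_ofReal.comp ?_) _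
    refine Continuous.div (by fun_prop) (by fun_prop) fun s => ?_
    exact (Real.sqrt_pos.2 (one_sub_sq_pos (mem_specTilde_iff.1 s.2).2.2)).ne'
  continuous_invFun := by
    refine Continuous.subtype_mk (Complex.continuous_ofReal.comp ?_) _
    refine Continuous.div (by fun_prop) (by fun_prop) fun x => ?_
    exact (Real.sqrt_pos.2 (by positivity)).ne'

theorem coe_specHomeo (hT : IsSelfAdjoint T) (s : specTilde (transform T)) :
    (specHomeo hT s : ℂ) = ((u (s : ℂ).re : ℝ) : ℂ) := rfl

theorem specHomeo_mul_sqrt (hT : IsSelfAdjoint T) (s : specTilde (transform T)) :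
    (specHomeo hT s : ℂ) * ((√(1 - (s : ℂ).re ^ 2) : ℝ) : ℂ) = s := by
  obtain ⟨-, h2, h3⟩ := mem_specTilde_iff.1 s.2
  have h4 : √(1 - (s : ℂ).re ^ 2) ≠ 0 := (Real.sqrt_pos.2 (one_sub_sq_pos h3)).ne'
  rw [coe_specHomeo, ← Complex.ofReal_mul, u, div_mul_cancel₀ _ h4, h2]

theorem compU_eq (hT : IsSelfAdjoint T) (h : spec T → ℂ) : compU T h = h ∘ specHomeo hT := by
  funext s
  exact Subtype.val_injective.extend_apply h 0 (specHomeo hT s)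

/-! ### The functional calculus on continuous functions vanishing at infinity -/

/-- The predicate underlying `C₀(X, ℂ)`. -/
def IsC0 {X : Type*} [TopologicalSpace X] (h : X → ℂ) : Prop :=
  Continuous h ∧ Tendsto h (cocompact X) (𝓝 0)

namespace IsC0

variable {X Y : Type*} [TopologicalSpace X] [TopologicalSpace Y]

theorem of_zeroAtInfty (h : C₀(X, ℂ)) : IsC0 h := ⟨h.continuous, h.zero_at_infty'⟩

theorem of_hasCompactSupport {h : X → ℂ} (hc : Continuous h) (hs : HasCompactSupport h) :
    IsC0 h := ⟨hc, hs.is_zero_at_infty⟩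

theorem of_compactlySupported (h : C_c(X, ℂ)) : IsC0 h :=
  of_hasCompactSupport h.continuous h.hasCompactSupport

theorem mul_compactlySupported {f : X → ℂ} (hf : Continuous f) (h : C_c(X, ℂ)) :
    IsC0 (f * (h : X → ℂ)) :=
  of_hasCompactSupport (hf.mul h.continuous) h.hasCompactSupport.mul_left

theorem bounded_mul {f h : X → ℂ} (hh : IsC0 h) (hf : Continuous f) {C : ℝ}
    (hb : ∀ x, ‖f x‖ ≤ C) : IsC0 (f * h) := by
  refine ⟨hf.mul hh.1, ?_⟩
  rw [tendsto_zero_iff_norm_tendsto_zero]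
  refine squeeze_zero (fun _ => norm_nonneg _) (fun x => ?_)
    (g := fun x => C * ‖h x‖) (by simpa using hh.2.norm.const_mul C)
  rw [Pi.mul_apply, norm_mul]
  exact mul_le_mul_of_nonneg_right (hb x) (norm_nonneg _)

theorem comp_homeomorph {h : Y → ℂ} (hh : IsC0 h) (e : X ≃ₜ Y) : IsC0 (h ∘ e) :=
  ⟨hh.1.comp e.continuous, hh.2.comp e.isClosedEmbedding.tendsto_cocompact⟩

/-- Extension by zero from a relatively open subset. -/
theorem continuousOn_extend {s V O : Set ℂ} (hO : IsOpen O) (hV : V = s ∩ O) {g : V → ℂ}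
    (hg : IsC0 g) : ContinuousOn (Function.extend Subtype.val g 0) s := by
  have hval : ∀ x : V, Function.extend Subtype.val g 0 (x : ℂ) = g x :=
    Subtype.val_injective.extend_apply g 0
  have hzero : ∀ x ∉ V, Function.extend Subtype.val g 0 x = 0 := fun x hx =>
    Function.extend_apply' _ _ _ (by rintro ⟨y, rfl⟩; exact hx y.2)
  intro x hx
  by_cases hxV : x ∈ V
  · have h1 : ContinuousOn (Function.extend Subtype.val g 0) V := by
      rw [continuousOn_iff_continuous_domRestrict]
      convert hg.1 using 1
      exact funext hval
    refine (h1 x hxV).mono_of_mem_nhdsWithin ?_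
    rw [hV] at hxV ⊢
    exact inter_mem_nhdsWithin s (hO.mem_nhds hxV.2)
  · rw [ContinuousWithinAt, hzero x hxV, Metric.tendsto_nhds]
    -- Off a compact `K ⊆ V` the function is smaller than `ε`, and `K` is closed in `ℂ` and misses
    -- `x`.
    intro ε hε
    have h1 := hg.2.eventually (Metric.ball_mem_nhds 0 hε)
    obtain ⟨K, hK, hKs⟩ := mem_cocompact.1 h1
    have h2 : (Subtype.val '' K)ᶜ ∈ 𝓝 x :=
      (hK.image continuous_subtype_val).isClosed.isOpen_compl.mem_nhds
        (by rintro ⟨y, -, rfl⟩; exact hxV y.2)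
    filter_upwards [mem_nhdsWithin_of_mem_nhds h2] with y hy
    by_cases hyV : y ∈ V
    · rw [hval ⟨y, hyV⟩]
      exact hKs fun hyK => hy ⟨⟨y, hyV⟩, hyK, rfl⟩
    · rw [hzero y hyV, dist_self]
      exact hε

end IsC0

/-- The function on `ℂ` whose continuous functional calculus at `S` is `h(T)`. -/
def liftFn (T : H →ₗ.[ℂ] H) (h : spec T → ℂ) : ℂ → ℂ := Function.extend Subtype.val (compU T h) 0

theorem fcZero_eq_cfc (h : spec T → ℂ) : fcZero T h = cfc (liftFn T h) (transform T) := rfl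

theorem liftFn_apply (hT : IsSelfAdjoint T) (h : spec T → ℂ) (s : specTilde (transform T)) :
    liftFn T h s = h (specHomeo hT s) := by
  rw [liftFn, Subtype.val_injective.extend_apply, compU_eq hT, Function.comp_apply]

theorem liftFn_apply_of_notMem (h : spec T → ℂ) {s : ℂ} (hs : s ∉ specTilde (transform T)) :
    liftFn T h s = 0 :=
  Function.extend_apply' _ _ _ (by rintro ⟨y, rfl⟩; exact hs y.2)

theorem continuousOn_liftFn (hT : IsSelfAdjoint T) {h : spec T → ℂ} (hh : IsC0 h) :
    ContinuousOn (liftFn T h) (spectrum ℂ (transform T)) := by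
  refine IsC0.continuousOn_extend (O := Complex.re ⁻¹' Set.Ioo (-1) 1)
    (isOpen_Ioo.preimage Complex.continuous_re) ?_ ?_
  · ext s
    rw [mem_specTilde_iff]
    constructor
    · exact fun h => ⟨h.1, h.2.2⟩
    · exact fun h => ⟨h.1, ((isSelfAdjoint_transform hT).mem_spectrum_eq_re h.1).symm, h.2⟩
  · rw [compU_eq hT]
    exact hh.comp_homeomorph _

section Hom

variable (hT : IsSelfAdjoint T)
include hT

theorem fcZero_mul {g h : spec T → ℂ} (hg : IsC0 g) (hh : IsC0 h) :
    fcZero T (g * h) = fcZero T g * fcZero T h := by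
  rw [fcZero_eq_cfc, fcZero_eq_cfc, fcZero_eq_cfc, ← cfc_mul _ _ _ (continuousOn_liftFn hT hg)
    (continuousOn_liftFn hT hh)]
  congr 1
  funext s
  by_cases hs : s ∈ specTilde (transform T)
  · simp only [liftFn_apply hT _ ⟨s, hs⟩, Pi.mul_apply]
  · simp only [liftFn_apply_of_notMem _ hs, mul_zero]

theorem fcZero_add {g h : spec T → ℂ} (hg : IsC0 g) (hh : IsC0 h) :
    fcZero T (g + h) = fcZero T g + fcZero T h := by
  rw [fcZero_eq_cfc, fcZero_eq_cfc, fcZero_eq_cfc, ← cfc_add _ _ _ (continuousOn_liftFn hT hg)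
    (continuousOn_liftFn hT hh)]
  congr 1
  funext s
  by_cases hs : s ∈ specTilde (transform T)
  · simp only [liftFn_apply hT _ ⟨s, hs⟩, Pi.add_apply]
  · simp only [liftFn_apply_of_notMem _ hs, add_zero]

theorem fcZero_smul (c : ℂ) {h : spec T → ℂ} (hh : IsC0 h) :
    fcZero T (c • h) = c • fcZero T h := by
  rw [fcZero_eq_cfc, fcZero_eq_cfc, ← cfc_smul _ _ _ (continuousOn_liftFn hT hh)]
  congr 1
  funext s
  by_cases hs : s ∈ specTilde (transform T)
  · simp only [liftFn_apply hT _ ⟨s, hs⟩, Pi.smul_apply]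
  · simp only [liftFn_apply_of_notMem _ hs, smul_zero]

theorem fcZero_star (h : spec T → ℂ) : fcZero T (star h) = star (fcZero T h) := by
  rw [fcZero_eq_cfc, fcZero_eq_cfc, ← cfc_star]
  congr 1
  funext s
  by_cases hs : s ∈ specTilde (transform T)
  · simp only [liftFn_apply hT _ ⟨s, hs⟩, Pi.star_apply]
  · simp only [liftFn_apply_of_notMem _ hs, star_zero]

theorem fcZero_star_apply_inner (h : spec T → ℂ) (x y : H) :
    ⟪fcZero T (star h) x, y⟫_ℂ = ⟪x, fcZero T h y⟫_ℂ := by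
  rw [fcZero_star hT, ContinuousLinearMap.star_eq_adjoint, ContinuousLinearMap.adjoint_inner_left]

theorem norm_fcZero_le {h : spec T → ℂ} {C : ℝ} (hC : 0 ≤ C) (hb : ∀ x, ‖h x‖ ≤ C) :
    ‖fcZero T h‖ ≤ C := by
  rw [fcZero_eq_cfc]
  refine norm_cfc_le hC fun s _ => ?_
  by_cases hs : s ∈ specTilde (transform T)
  · rw [liftFn_apply hT _ ⟨s, hs⟩]
    exact hb _
  · rwa [liftFn_apply_of_notMem _ hs, norm_zero]

theorem norm_apply_le_norm_fcZero {h : spec T → ℂ} (hh : IsC0 h) (x : spec T) :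
    ‖h x‖ ≤ ‖fcZero T h‖ := by
  have : IsStarNormal (transform T) := (isSelfAdjoint_transform hT).isStarNormal
  obtain ⟨s, rfl⟩ := (specHomeo hT).surjective x
  rw [← liftFn_apply hT h s]
  exact norm_apply_le_norm_cfc _ _ (mem_specTilde_iff.1 s.2).1 (continuousOn_liftFn hT hh)

/-- The `C₀`-functional calculus as an isometric `*`-homomorphism into `C*(S)`. -/
theorem exists_starHom : ∃ Φ : C₀(spec T, ℂ) →⋆ₙₐ[ℂ] StarAlgebra.elemental ℂ (transform T),
    Isometry Φ ∧ ∀ f, (Φ f : H →L[ℂ] H) = fcZero T f := by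
  have hN : IsStarNormal (transform T) := (isSelfAdjoint_transform hT).isStarNormal
  let Φ : C₀(spec T, ℂ) →⋆ₙₐ[ℂ] StarAlgebra.elemental ℂ (transform T) :=
    { toFun := fun f => ⟨fcZero T f, cfc_mem_elemental _ _⟩
      map_smul' := fun c f => Subtype.ext (fcZero_smul hT c (.of_zeroAtInfty f))
      map_zero' := Subtype.ext (by
        simpa using fcZero_smul hT 0 (IsC0.of_zeroAtInfty (0 : C₀(spec T, ℂ))))
      map_add' := fun f g => Subtype.ext
        (fcZero_add hT (.of_zeroAtInfty f) (.of_zeroAtInfty g))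
      map_mul' := fun f g => Subtype.ext
        (fcZero_mul hT (.of_zeroAtInfty f) (.of_zeroAtInfty g))
      map_star' := fun f => Subtype.ext (fcZero_star hT f) }
  refine ⟨Φ, ?_, fun f => rfl⟩
  refine AddMonoidHomClass.isometry_of_norm Φ fun f => ?_
  change ‖fcZero T f‖ = ‖f‖
  have h1 : ∀ {C : ℝ}, 0 ≤ C → (‖f‖ ≤ C ↔ ∀ x, ‖f x‖ ≤ C) := fun hC => by
    rw [← ZeroAtInftyContinuousMap.norm_toBCF_eq_norm, BoundedContinuousFunction.norm_le hC]
    rfl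
  refine le_antisymm ?_ ?_
  · exact norm_fcZero_le hT (norm_nonneg _) ((h1 (norm_nonneg _)).1 le_rfl)
  · exact (h1 (norm_nonneg _)).2 fun x => norm_apply_le_norm_fcZero hT (.of_zeroAtInfty f) x

/-- Transfers pointwise identities on `σ̃(S)` to products with `S` and `B`, whose symbols are not
themselves extended by zero: the `C₀` factors vanish off `σ̃(S)`. -/
theorem fcZero_mul_cfc {g h : spec T → ℂ} (hg : IsC0 g) (hh : IsC0 h) {φ ψ : ℂ → ℂ}
    (hφ : Continuous φ) (hψ : Continuous ψ)
    (heq : ∀ s : specTilde (transform T), g (specHomeo hT s) * φ s = h (specHomeo hT s) * ψ s) :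
    fcZero T g * cfc φ (transform T) = fcZero T h * cfc ψ (transform T) := by
  rw [fcZero_eq_cfc, fcZero_eq_cfc,
    ← cfc_mul _ _ _ (continuousOn_liftFn hT hg) hφ.continuousOn,
    ← cfc_mul _ _ _ (continuousOn_liftFn hT hh) hψ.continuousOn]
  congr 1
  funext s
  by_cases hs : s ∈ specTilde (transform T)
  · simpa only [liftFn_apply hT _ ⟨s, hs⟩] using heq ⟨s, hs⟩
  · simp only [liftFn_apply_of_notMem _ hs, zero_mul]

/-! ### Cutoff functions -/

theorem hasCompactSupport_cutoff (n : ℕ) :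
    HasCompactSupport fun x : spec T => ((max 0 (min 1 (n + 1 - ‖(x : ℂ)‖)) : ℝ) : ℂ) := by
  refine HasCompactSupport.intro (K := Subtype.val ⁻¹' Metric.closedBall (0 : ℂ) (n + 1))
    ((isClosed_spec hT).isClosedEmbedding_subtypeVal.isCompact_preimage
      (isCompact_closedBall _ _)) fun x hx => ?_
  have : (n : ℝ) + 1 < ‖(x : ℂ)‖ := by simpa using hx
  rw [max_eq_left ((min_le_right _ _).trans (by linarith)), Complex.ofReal_zero]

/-- A sequence of compactly supported functions increasing to `1` on `σ(T)`. -/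
def cutoff (n : ℕ) : C_c(spec T, ℂ) where
  toFun x := ((max 0 (min 1 (n + 1 - ‖(x : ℂ)‖)) : ℝ) : ℂ)
  continuous_toFun := by fun_prop
  hasCompactSupport' := hasCompactSupport_cutoff hT n

theorem cutoff_apply (n : ℕ) (x : spec T) :
    cutoff hT n x = ((max 0 (min 1 (n + 1 - ‖(x : ℂ)‖)) : ℝ) : ℂ) := rfl

theorem cutoff_eq_one {n : ℕ} {x : spec T} (hx : ‖(x : ℂ)‖ ≤ n) : cutoff hT n x = 1 := by
  rw [cutoff_apply, min_eq_left (by linarith), max_eq_right zero_le_one, Complex.ofReal_one]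

theorem norm_cutoff_le (n : ℕ) (x : spec T) : ‖cutoff hT n x‖ ≤ 1 := by
  rw [cutoff_apply, Complex.norm_real, Real.norm_of_nonneg (le_max_left _ _)]
  exact max_le zero_le_one (min_le_left _ _)

theorem norm_cutoff_sub_one_le (n : ℕ) (x : spec T) : ‖cutoff hT n x - 1‖ ≤ 1 := by
  rw [cutoff_apply, ← Complex.ofReal_one, ← Complex.ofReal_sub, Complex.norm_real, Real.norm_eq_abs,
    abs_le]
  have h1 := le_max_left 0 (min 1 ((n : ℝ) + 1 - ‖(x : ℂ)‖))
  have h2 : max 0 (min 1 ((n : ℝ) + 1 - ‖(x : ℂ)‖)) ≤ 1 := max_le zero_le_one (min_le_left _ _)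
  constructor <;> linarith

theorem star_cutoff (n : ℕ) : star (cutoff hT n : spec T → ℂ) = cutoff hT n := by
  funext x
  rw [Pi.star_apply, cutoff_apply]
  exact Complex.conj_ofReal _

/-- The symbol of `B` is small where the cutoff differs from `1`, because `|u(s)| √(1 - s²) = |s| ≤
1`. -/
theorem norm_fcZero_cutoff_mul_invSqrt_sub_le (n : ℕ) :
    ‖fcZero T (cutoff hT n) * invSqrt T - invSqrt T‖ ≤ 2 / (n + 1) := by
  have hc := continuousOn_liftFn hT (.of_compactlySupported (cutoff hT n))
  rw [fcZero_eq_cfc, invSqrt_eq_cfc hT, ← cfc_mul _ _ _ hc (by fun_prop),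
    ← cfc_sub _ _ _ (by fun_prop) (by fun_prop)]
  have h0 : (0 : ℝ) ≤ 2 / (n + 1) := by positivity
  refine norm_cfc_le h0 fun s hs' => ?_
  rw [← sub_one_mul, norm_mul, Complex.norm_real, Real.norm_of_nonneg (Real.sqrt_nonneg _)]
  by_cases hs : s ∈ specTilde (transform T)
  · obtain ⟨-, h2, h3⟩ := mem_specTilde_iff.1 hs
    rw [liftFn_apply hT _ ⟨s, hs⟩]
    have hsq : √(1 - s.re ^ 2) ≤ 1 := Real.sqrt_le_one.2 (by nlinarith [sq_nonneg s.re])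
    by_cases hn : ‖(specHomeo hT ⟨s, hs⟩ : ℂ)‖ ≤ n
    · rwa [cutoff_eq_one hT hn, sub_self, norm_zero, zero_mul]
    · refine (mul_le_of_le_one_left (Real.sqrt_nonneg _) (norm_cutoff_sub_one_le hT _ _)).trans ?_
      have h4 := congr(‖$(specHomeo_mul_sqrt hT ⟨s, hs⟩)‖)
      rw [norm_mul, Complex.norm_real, Real.norm_of_nonneg (Real.sqrt_nonneg _)] at h4
      have h5 : ‖s‖ ≤ 1 := by
        rw [← h2, Complex.norm_real]
        exact (abs_lt.2 h3).le
      -- With `r = √(1 - s²)`, adding `n r ≤ |s| ≤ 1` and `r ≤ 1` gives `(n + 1) r ≤ 2`, which also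
      -- covers `n = 0`.
      rw [le_div_iff₀ (by positivity)]
      have := mul_le_mul_of_nonneg_right (not_le.1 hn).le (Real.sqrt_nonneg (1 - s.re ^ 2))
      simp only at h4
      nlinarith
  · have h1 : √(1 - s.re ^ 2) = 0 := by
      refine Real.sqrt_eq_zero_of_nonpos ?_
      by_contra! h
      refine hs (mem_specTilde_iff.2 ⟨hs', ((isSelfAdjoint_transform hT).mem_spectrum_eq_re
        hs').symm, abs_lt.1 ?_⟩)
      rw [← sq_lt_one_iff_abs_lt_one]
      linarith
    rwa [h1, mul_zero]

/-- The norm estimate gives convergence on the range of `B`; density and `‖eₙ(T)‖ ≤ 1` extend it to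
`H`. -/
theorem tendsto_fcZero_cutoff (x : H) :
    Tendsto (fun n => fcZero T (cutoff hT n) x) atTop (𝓝 x) := by
  have hrange : ∀ w, Tendsto (fun n => fcZero T (cutoff hT n) (invSqrt T w)) atTop
      (𝓝 (invSqrt T w)) := by
    intro w
    rw [tendsto_iff_norm_sub_tendsto_zero]
    have h0 : Tendsto (fun n : ℕ => 2 / ((n : ℝ) + 1) * ‖w‖) atTop (𝓝 0) := by
      have := (tendsto_one_div_add_atTop_nhds_zero_nat (𝕜 := ℝ)).const_mul 2 |>.mul_const ‖w‖
      simpa [div_eq_mul_inv] using this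
    refine squeeze_zero (fun _ => norm_nonneg _) (fun n => ?_) h0
    exact ((fcZero T (cutoff hT n) * invSqrt T - invSqrt T).le_opNorm w).trans
      (mul_le_mul_of_nonneg_right (norm_fcZero_cutoff_mul_invSqrt_sub_le hT n) (norm_nonneg _))
  rw [Metric.tendsto_atTop]
  intro ε hε
  obtain ⟨w, hw⟩ := (denseRange_invSqrt hT).exists_dist_lt x (show 0 < ε / 3 by positivity)
  obtain ⟨N, hN⟩ := Metric.tendsto_atTop.1 (hrange w) (ε / 3) (by positivity)
  refine ⟨N, fun n hn => ?_⟩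
  have h1 : dist (fcZero T (cutoff hT n) x) (fcZero T (cutoff hT n) (invSqrt T w)) ≤
      dist x (invSqrt T w) := by
    rw [dist_eq_norm, dist_eq_norm, ← map_sub]
    exact ((fcZero T (cutoff hT n)).le_opNorm _).trans (mul_le_of_le_one_left (norm_nonneg _)
      (norm_fcZero_le hT zero_le_one (norm_cutoff_le hT n)))
  have h2 := hN n hn
  have h3 := dist_triangle4 (fcZero T (cutoff hT n) x) (fcZero T (cutoff hT n) (invSqrt T w))
    (invSqrt T w) x
  rw [dist_comm (invSqrt T w) x] at h3
  linarith

end Hom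

/-! ### The graph of `f(T)` -/

/-- The pairs `(x, y)` with `h(T) y = (f h)(T) x` for all `h ∈ C_c(σ(T))`; this is the graph of
`f(T)`. -/
def calcGraph (T : H →ₗ.[ℂ] H) (f : spec T → ℂ) : Submodule ℂ (H × H) where
  carrier := {p | ∀ h : C_c(spec T, ℂ), fcZero T h p.2 = fcZero T (f * (h : spec T → ℂ)) p.1}
  add_mem' hp hq h := by simp only [Prod.fst_add, Prod.snd_add, map_add, hp h, hq h]
  zero_mem' h := by simp
  smul_mem' c p hp h := by simp only [Prod.smul_fst, Prod.smul_snd, map_smul, hp h]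

theorem mem_calcGraph {f : spec T → ℂ} {x y : H} : (x, y) ∈ calcGraph T f ↔
    ∀ h : C_c(spec T, ℂ), fcZero T h y = fcZero T (f * (h : spec T → ℂ)) x := Iff.rfl

theorem isClosed_calcGraph (f : spec T → ℂ) : IsClosed (calcGraph T f : Set (H × H)) := by
  have : (calcGraph T f : Set (H × H)) = ⋂ h : C_c(spec T, ℂ),
      {p : H × H | fcZero T h p.2 = fcZero T (f * (h : spec T → ℂ)) p.1} := by
    ext p
    simp only [Set.mem_iInter]
    rfl
  rw [this]
  exact isClosed_iInter fun h => isClosed_eq (by fun_prop) (by fun_prop)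

section SelfAdjoint

variable (hT : IsSelfAdjoint T) {f : spec T → ℂ}
include hT

theorem snd_eq_zero_of_mem_calcGraph {y : H} (h : (0, y) ∈ calcGraph T f) : y = 0 := by
  refine tendsto_nhds_unique (tendsto_fcZero_cutoff hT y) ?_
  simp only [mem_calcGraph.1 h, map_zero, tendsto_const_nhds_iff]

theorem eq_of_mem_calcGraph {x y z : H} (h : (x, y) ∈ calcGraph T f)
    (h' : (x, z) ∈ calcGraph T f) : y = z := by
  rw [← sub_eq_zero]
  exact snd_eq_zero_of_mem_calcGraph hT (by simpa using (calcGraph T f).sub_mem h h')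

theorem fcZero_mem_calcGraph (hf : Continuous f) {h : spec T → ℂ} (hh : IsC0 h)
    (hfh : IsC0 (f * h)) (ψ : H) : (fcZero T h ψ, fcZero T (f * h) ψ) ∈ calcGraph T f := by
  intro k
  change (fcZero T k * fcZero T (f * h)) ψ = (fcZero T (f * (k : spec T → ℂ)) * fcZero T h) ψ
  rw [← fcZero_mul hT (.of_compactlySupported k) hfh,
    ← fcZero_mul hT (.mul_compactlySupported hf k) hh, mul_left_comm, mul_assoc]

/-- Applying `eₙ(T)` to both entries of `(x, y)` gives the generator `(eₙ(T) x, (f eₙ)(T) x)`, which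
converges to `(x, y)`. -/
theorem topologicalClosure_eq_calcGraph {G : Submodule ℂ (H × H)}
    (hG : ∀ (h : C_c(spec T, ℂ)) (ψ : H),
      (fcZero T h ψ, fcZero T (f * (h : spec T → ℂ)) ψ) ∈ G)
    (hle : G ≤ calcGraph T f) : G.topologicalClosure = calcGraph T f := by
  refine le_antisymm (G.topologicalClosure_minimal hle (isClosed_calcGraph f)) ?_
  rintro ⟨x, y⟩ hxy
  refine mem_closure_of_tendsto
    ((tendsto_fcZero_cutoff hT x).prodMk_nhds (tendsto_fcZero_cutoff hT y))
    (Eventually.of_forall fun n => ?_)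
  rw [mem_calcGraph.1 hxy]
  exact hG _ _

theorem isClosable_of_graph_le {P : H →ₗ.[ℂ] H} (hle : P.graph ≤ calcGraph T f) :
    P.IsClosable := by
  refine ⟨P.graph.topologicalClosure.toLinearPMap, ?_⟩
  rw [Submodule.toLinearPMap_graph_eq]
  rintro ⟨x, y⟩ hx (rfl : x = 0)
  exact snd_eq_zero_of_mem_calcGraph hT
    (P.graph.topologicalClosure_minimal hle (isClosed_calcGraph f) hx)

theorem closure_graph_eq_calcGraph {P : H →ₗ.[ℂ] H}
    (hG : ∀ (h : C_c(spec T, ℂ)) (ψ : H),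
      (fcZero T h ψ, fcZero T (f * (h : spec T → ℂ)) ψ) ∈ P.graph)
    (hle : P.graph ≤ calcGraph T f) : P.closure.graph = calcGraph T f := by
  rw [← (isClosable_of_graph_le hT hle).graph_closure_eq_closure_graph,
    topologicalClosure_eq_calcGraph hT hG hle]

theorem dense_domain_of_mem_graph {P : H →ₗ.[ℂ] H}
    (hG : ∀ (h : C_c(spec T, ℂ)) (ψ : H),
      (fcZero T h ψ, fcZero T (f * (h : spec T → ℂ)) ψ) ∈ P.graph) :
    Dense (P.domain : Set H) := fun x =>
  mem_closure_of_tendsto (tendsto_fcZero_cutoff hT x)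
    (Eventually.of_forall fun n => LinearPMap.mem_domain_of_mem_graph (hG (cutoff hT n) x))

/-- Testing against the generators for `star k` gives one inclusion. For the other, insert the real
cutoffs `eₙ(T)` into the inner products and pass to the limit. `P` may be `f₀(T)` or its closure. -/
theorem adjoint_graph_eq_calcGraph {P : H →ₗ.[ℂ] H}
    (hG : ∀ (h : C_c(spec T, ℂ)) (ψ : H),
      (fcZero T h ψ, fcZero T (f * (h : spec T → ℂ)) ψ) ∈ P.graph)
    (hle : P.graph ≤ calcGraph T f) : P.adjoint.graph = calcGraph T (star f) := by
  rw [LinearPMap.adjoint_graph_eq_graph_adjoint (dense_domain_of_mem_graph hT hG)]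
  ext ⟨v, w⟩
  rw [Submodule.mem_adjoint_iff, mem_calcGraph]
  simp only [sub_eq_zero]
  constructor
  · intro h k
    refine ext_inner_left ℂ fun ψ => ?_
    rw [← fcZero_star_apply_inner hT, ← fcZero_star_apply_inner hT, star_mul', star_star]
    exact (h _ _ (hG (star k) ψ)).symm
  · intro h a b hab
    have h1 : Tendsto (fun n => ⟪b, fcZero T (cutoff hT n) v⟫_ℂ) atTop (𝓝 ⟪b, v⟫_ℂ) :=
      tendsto_const_nhds.inner (tendsto_fcZero_cutoff hT v)
    have h2 : Tendsto (fun n => ⟪a, fcZero T (cutoff hT n) w⟫_ℂ) atTop (𝓝 ⟪a, w⟫_ℂ) :=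
      tendsto_const_nhds.inner (tendsto_fcZero_cutoff hT w)
    refine tendsto_nhds_unique h1 (h2.congr fun n => ?_)
    rw [h, ← fcZero_star_apply_inner hT, ← fcZero_star_apply_inner hT, star_mul', star_star,
      star_cutoff, mem_calcGraph.1 (hle hab)]

end SelfAdjoint

/-! ### The operators `f₀(T)` -/

omit [CompleteSpace H] in
-- The domain of `toLinearPMap` is the first projection of the given subspace, so this identifies
-- the domains of `f₀(T)`.
theorem map_fst_span_eq {F G : Type*} (φ ψ : F → H →L[ℂ] H) (χ : G → H →L[ℂ] H)
    (h1 : ∀ h : F, ∃ g : G, χ g = φ h) (h2 : ∀ g : G, ∃ h : F, φ h = χ g) :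
    (Submodule.span ℂ {p : H × H | ∃ (h : F) (x : H), p = (φ h x, ψ h x)}).map
      (LinearMap.fst ℂ H H) = Submodule.span ℂ {y | ∃ (g : G) (x : H), y = χ g x} := by
  rw [Submodule.map_span]
  congr 1
  ext y
  constructor
  · rintro ⟨_, ⟨h, x, rfl⟩, rfl⟩
    obtain ⟨g, hg⟩ := h1 h
    exact ⟨g, x, by rw [hg]; rfl⟩
  · rintro ⟨g, x, rfl⟩
    obtain ⟨h, hh⟩ := h2 g
    exact ⟨_, ⟨h, x, rfl⟩, by rw [← hh]; rfl⟩

section Pre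

variable (hT : IsSelfAdjoint T)
include hT

theorem fcZero_eq_calcS_comp (h : spec T → ℂ) :
    fcZero T h = calcS (transform T) (h ∘ specHomeo hT) := by
  rw [fcZero, compU_eq hT]

theorem calcS_eq_fcZero_comp (g : specTilde (transform T) → ℂ) :
    calcS (transform T) g = fcZero T (g ∘ (specHomeo hT).symm) := by
  rw [fcZero_eq_calcS_comp hT, Function.comp_assoc, (specHomeo hT).symm_comp_self,
    Function.comp_id]

theorem fcPre_graph (f : C(spec T, ℂ)) : (fcPre T f).graph =
      Submodule.span ℂ {p : H × H | ∃ (h : C_c(spec T, ℂ)) (ψ : H),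
        p = (fcZero T h ψ, fcZero T (f * h) ψ)} ∧
    (fcPre T f).graph ≤ calcGraph T f := by
  have hle : Submodule.span ℂ {p : H × H | ∃ (h : C_c(spec T, ℂ)) (ψ : H),
      p = (fcZero T h ψ, fcZero T (f * h) ψ)} ≤ calcGraph T f := by
    rw [Submodule.span_le]
    rintro _ ⟨h, ψ, rfl⟩
    exact fcZero_mem_calcGraph hT f.continuous (.of_compactlySupported h)
      (.mul_compactlySupported f.continuous h) ψ
  have : (fcPre T f).graph = _ := Submodule.toLinearPMap_graph_eq _ (by
    rintro ⟨x, y⟩ hx (rfl : x = 0)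
    exact snd_eq_zero_of_mem_calcGraph hT (hle hx))
  exact ⟨this, this.trans_le hle⟩

theorem fcPre_graph_le (f : C(spec T, ℂ)) : (fcPre T f).graph ≤ calcGraph T f :=
  (fcPre_graph hT f).2

theorem mem_fcPre_graph (f : C(spec T, ℂ)) (h : C_c(spec T, ℂ)) (ψ : H) :
    (fcZero T h ψ, fcZero T (f * h) ψ) ∈ (fcPre T f).graph := by
  rw [(fcPre_graph hT f).1]
  exact Submodule.subset_span ⟨h, ψ, rfl⟩

theorem fcPre_domain (f : C(spec T, ℂ)) : (fcPre T f).domain = ccRange (transform T) := by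
  refine map_fst_span_eq (F := C_c(spec T, ℂ)) (G := C_c(specTilde (transform T), ℂ))
    (fun h => fcZero T h) (fun h => fcZero T (f * h))
    (fun g => calcS (transform T) g) ?_ ?_
  · exact fun h => ⟨⟨⟨h ∘ specHomeo hT, h.continuous.comp (specHomeo hT).continuous⟩,
      h.hasCompactSupport.comp_homeomorph _⟩, (fcZero_eq_calcS_comp hT _).symm⟩
  · exact fun g => ⟨⟨⟨g ∘ (specHomeo hT).symm, g.continuous.comp (specHomeo hT).symm.continuous⟩,
      g.hasCompactSupport.comp_homeomorph _⟩, (calcS_eq_fcZero_comp hT _).symm⟩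

theorem fcPreBounded_graph (f : spec T →ᵇ ℂ) : (fcPreBounded T f).graph =
      Submodule.span ℂ {p : H × H | ∃ (h : C₀(spec T, ℂ)) (ψ : H),
        p = (fcZero T h ψ, fcZero T (f * h) ψ)} ∧
    (fcPreBounded T f).graph ≤ calcGraph T f := by
  have hle : Submodule.span ℂ {p : H × H | ∃ (h : C₀(spec T, ℂ)) (ψ : H),
      p = (fcZero T h ψ, fcZero T (f * h) ψ)} ≤ calcGraph T f := by
    rw [Submodule.span_le]
    rintro _ ⟨h, ψ, rfl⟩
    exact fcZero_mem_calcGraph hT f.continuous (.of_zeroAtInfty h)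
      ((IsC0.of_zeroAtInfty h).bounded_mul f.continuous f.norm_coe_le_norm) ψ
  have : (fcPreBounded T f).graph = _ := Submodule.toLinearPMap_graph_eq _ (by
    rintro ⟨x, y⟩ hx (rfl : x = 0)
    exact snd_eq_zero_of_mem_calcGraph hT (hle hx))
  exact ⟨this, this.trans_le hle⟩

theorem fcPreBounded_graph_le (f : spec T →ᵇ ℂ) : (fcPreBounded T f).graph ≤ calcGraph T f :=
  (fcPreBounded_graph hT f).2

theorem mem_fcPreBounded_graph (f : spec T →ᵇ ℂ) (h : C₀(spec T, ℂ)) (ψ : H) :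
    (fcZero T h ψ, fcZero T (f * h) ψ) ∈ (fcPreBounded T f).graph := by
  rw [(fcPreBounded_graph hT f).1]
  exact Submodule.subset_span ⟨h, ψ, rfl⟩

theorem mem_fcPreBounded_graph_of_compactlySupported (f : spec T →ᵇ ℂ) (h : C_c(spec T, ℂ))
    (ψ : H) :
    (fcZero T h ψ, fcZero T (f * (h : spec T → ℂ)) ψ) ∈ (fcPreBounded T f).graph :=
  mem_fcPreBounded_graph hT f ⟨h.toContinuousMap, h.hasCompactSupport.is_zero_at_infty⟩ ψ

theorem fcPreBounded_domain (f : spec T →ᵇ ℂ) :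
    (fcPreBounded T f).domain = c0Range (transform T) := by
  refine map_fst_span_eq (F := C₀(spec T, ℂ)) (G := C₀(specTilde (transform T), ℂ))
    (fun h => fcZero T h) (fun h => fcZero T (f * h))
    (fun g => calcS (transform T) g) ?_ ?_
  · exact fun h => ⟨⟨⟨h ∘ specHomeo hT, h.continuous.comp (specHomeo hT).continuous⟩,
      ((IsC0.of_zeroAtInfty h).comp_homeomorph _).2⟩, (fcZero_eq_calcS_comp hT _).symm⟩
  · exact fun g => ⟨⟨⟨g ∘ (specHomeo hT).symm, g.continuous.comp (specHomeo hT).symm.continuous⟩,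
      ((IsC0.of_zeroAtInfty g).comp_homeomorph _).2⟩, (calcS_eq_fcZero_comp hT _).symm⟩

/-! ### The operators `f(T)` -/

theorem fc_graph (f : C(spec T, ℂ)) : (fc T f).graph = calcGraph T f :=
  closure_graph_eq_calcGraph hT (mem_fcPre_graph hT f) (fcPre_graph_le hT f)

theorem fcPreBounded_closure (f : spec T →ᵇ ℂ) :
    (fcPreBounded T f).closure = fc T f.toContinuousMap := by
  apply LinearPMap.eq_of_eq_graph
  rw [fc_graph hT, closure_graph_eq_calcGraph hT
    (mem_fcPreBounded_graph_of_compactlySupported hT f) (fcPreBounded_graph_le hT f)]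
  rfl

theorem fcPre_adjoint (f : C(spec T, ℂ)) : (fcPre T f).adjoint = fc T (star f) := by
  apply LinearPMap.eq_of_eq_graph
  rw [fc_graph hT, adjoint_graph_eq_calcGraph hT (mem_fcPre_graph hT f) (fcPre_graph_le hT f)]
  rfl

theorem fc_adjoint (f : C(spec T, ℂ)) : (fc T f).adjoint = fc T (star f) := by
  apply LinearPMap.eq_of_eq_graph
  rw [fc_graph hT, adjoint_graph_eq_calcGraph hT _ (fc_graph hT f).le]
  · rfl
  · exact fun h ψ => LinearPMap.le_graph_of_le (LinearPMap.le_closure _) (mem_fcPre_graph hT f h ψ)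

/-- `calcGraph T f` is single-valued, so an everywhere defined operator inside it exhausts it. -/
theorem fc_eq_of_forall_mem {f : C(spec T, ℂ)} {A : H →ₗ.[ℂ] H}
    (hA : A.graph ≤ calcGraph T f) (hdom : ∀ x, x ∈ A.domain) : fc T f = A := by
  apply LinearPMap.eq_of_eq_graph
  refine le_antisymm ?_ (hA.trans (fc_graph hT f).ge)
  rintro ⟨x, y⟩ hxy
  rw [fc_graph hT] at hxy
  have h1 := A.mem_graph ⟨x, hdom x⟩
  rw [eq_of_mem_calcGraph hT hxy (hA h1)]
  exact h1

theorem fc_zeroAtInfty (f : C₀(spec T, ℂ)) :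
    fc T f.toContinuousMap = ofBounded (fcZero T f) := by
  refine fc_eq_of_forall_mem hT ?_ fun x => Submodule.mem_top
  rintro ⟨x, y⟩ hxy
  rw [mem_graph_ofBounded] at hxy
  subst hxy
  intro k
  change (fcZero T k * fcZero T f) x = fcZero T ((f : spec T → ℂ) * (k : spec T → ℂ)) x
  rw [← fcZero_mul hT (.of_compactlySupported k) (.of_zeroAtInfty f), mul_comm]

theorem fc_one : fc T 1 = ofBounded (ContinuousLinearMap.id ℂ H) := by
  refine fc_eq_of_forall_mem hT ?_ fun x => Submodule.mem_top
  rintro ⟨x, y⟩ hxy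
  rw [mem_graph_ofBounded] at hxy
  subst hxy
  intro k
  rw [ContinuousMap.coe_one, one_mul]
  rfl

theorem fc_resolventFun (z : ℂ) (hz : z ∈ resolvSet T) :
    fc T (resolventFun T z hz) = (subScalar T z).inverse := by
  have hN : IsStarNormal (transform T) := (isSelfAdjoint_transform hT).isStarNormal
  have hinj : ∀ x, (x, 0) ∈ (subScalar T z).graph → x = 0 := by
    intro x hx
    obtain ⟨⟨a, ha⟩, rfl, h⟩ := (LinearPMap.mem_graph_iff _).1 hx
    exact congrArg Subtype.val (hz.1 (h.trans (map_zero (subScalar T z).toFun).symm))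
  refine fc_eq_of_forall_mem hT ?_ fun x => ?_
  · rintro ⟨x, y⟩ hxy
    rw [mem_graph_inverse hinj, mem_graph_subScalar_iff_transform hT] at hxy
    obtain ⟨a, rfl, rfl⟩ := hxy
    intro k
    -- The graph of `(T - z)⁻¹` consists of the pairs `((S - z B) a, B a)`, so the claim is `k(T) B
    -- = (r k)(T) (S - z B)` with `r = (id - z)⁻¹`.
    have := fcZero_mul_cfc hT (.of_compactlySupported k)
      (.mul_compactlySupported (resolventFun T z hz).continuous k)
      (φ := fun s : ℂ => ((√(1 - s.re ^ 2) : ℝ) : ℂ))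
      (ψ := fun s : ℂ => s - z * ((√(1 - s.re ^ 2) : ℝ) : ℂ)) (by fun_prop) (by fun_prop) ?_
    · rw [← invSqrt_eq_cfc hT, ← transform_sub_smul_invSqrt_eq_cfc hT] at this
      exact congr($this a)
    · intro s
      have h1 : (specHomeo hT s : ℂ) - z ≠ 0 := fun h =>
        (specHomeo hT s).2 (by rwa [sub_eq_zero.1 h])
      have h2 := specHomeo_mul_sqrt hT s
      have h3 : resolventFun T z hz (specHomeo hT s) = ((specHomeo hT s : ℂ) - z)⁻¹ := rfl
      rw [Pi.mul_apply, h3]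
      field_simp
      linear_combination k (specHomeo hT s) * h2
  · rw [LinearPMap.inverse_domain]
    exact hz.2 x

theorem fc_idFun : fc T (idFun T) = T := by
  have hN : IsStarNormal (transform T) := (isSelfAdjoint_transform hT).isStarNormal
  have hle : T.graph ≤ (fc T (idFun T)).graph := by
    rw [fc_graph hT]
    rintro ⟨x, y⟩ hxy
    obtain ⟨a, rfl, rfl⟩ := (mem_graph_iff_transform hT).1 hxy
    intro k
    have := fcZero_mul_cfc hT (.of_compactlySupported k)
      (.mul_compactlySupported (idFun T).continuous k)
      (φ := fun s : ℂ => s)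
      (ψ := fun s : ℂ => ((√(1 - s.re ^ 2) : ℝ) : ℂ)) (by fun_prop) (by fun_prop) ?_
    · rw [← invSqrt_eq_cfc hT, cfc_id' ..] at this
      exact congr($this a)
    · intro s
      have h3 : idFun T (specHomeo hT s) = (specHomeo hT s : ℂ) := rfl
      rw [Pi.mul_apply, h3]
      linear_combination -(k (specHomeo hT s)) * specHomeo_mul_sqrt hT s
  -- Self-adjoint operators are maximal: `T ⊆ id(T)` gives `id(T) = id(T)* ⊆ T* = T`, using that
  -- `σ(T)` is real.
  refine (LinearPMap.eq_of_eq_graph (le_antisymm hle ?_)).symm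
  have hstar : star (idFun T) = idFun T := by
    ext x
    obtain ⟨s, -, hs⟩ := (mem_spec_iff hT).1 x.2
    change star (x : ℂ) = x
    rw [← hs]
    exact Complex.conj_ofReal _
  rintro ⟨v, w⟩ hvw
  rw [mem_graph_iff_of_isSelfAdjoint hT]
  intro a b hab
  have hdense : Dense ((fc T (idFun T)).domain : Set H) :=
    hT.dense_domain.mono (LinearPMap.le_of_le_graph hle).1
  rw [← hstar, ← fc_adjoint hT, LinearPMap.adjoint_graph_eq_graph_adjoint hdense,
    Submodule.mem_adjoint_iff] at hvw
  exact sub_eq_zero.1 (hvw a b (hle hab))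

end Pre

end BoundedTransform

end

theorem theorem2 {H : Type*} [NormedAddCommGroup H] [InnerProductSpace ℂ H] [CompleteSpace H]
    (T : H →ₗ.[ℂ] H) (hT : IsSelfAdjoint T) :
    -- for `f ∈ C(σ(T))`, the operator `f₀(T)` is well defined on the dense domain `C*_c(S)H`, and
    -- it is closable; `f(T)` is its closure, and `f(T)* = f*(T)`
    (∀ f : C(spec T, ℂ),
      (∀ (h : C_c(spec T, ℂ)) (ψ : H), ∃ hψ : fcZero T h ψ ∈ (fcPre T f).domain,
        fcPre T f ⟨fcZero T h ψ, hψ⟩ = fcZero T (f * h) ψ) ∧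
      (fcPre T f).domain = ccRange (transform T) ∧
      Dense ((fcPre T f).domain : Set H) ∧
      (fcPre T f).IsClosable ∧
      (fc T f).adjoint = fc T (star f)) ∧
    -- for bounded `f`, `f₀(T)` is also well defined on the dense domain `C*_0(S)H`, with the same
    -- closure `f(T)`
    (∀ f : spec T →ᵇ ℂ,
      (∀ (h : C₀(spec T, ℂ)) (ψ : H), ∃ hψ : fcZero T h ψ ∈ (fcPreBounded T f).domain,
        fcPreBounded T f ⟨fcZero T h ψ, hψ⟩ = fcZero T (f * h) ψ) ∧
      (fcPreBounded T f).domain = c0Range (transform T) ∧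
      Dense ((fcPreBounded T f).domain : Set H) ∧
      (fcPreBounded T f).IsClosable ∧
      (fcPreBounded T f).closure = fc T f.toContinuousMap) ∧
    -- for real-valued `f`, `f(T)` is self-adjoint, i.e. `f₀(T)⁻ = f₀(T)*`
    (∀ f : C(spec T, ℂ), (∀ x, (f x).im = 0) →
      IsSelfAdjoint (fc T f) ∧ (fcPre T f).closure = (fcPre T f).adjoint) ∧
    -- `f ↦ f(T)` restricts to an isometric *-homomorphism from `C₀(σ(T))` to `C*(S)`, which is
    -- given by `f(T) = (f ∘ u)(S)`
    (∃ Φ : C₀(spec T, ℂ) →⋆ₙₐ[ℂ] StarAlgebra.elemental ℂ (transform T),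
      Isometry Φ ∧ ∀ f : C₀(spec T, ℂ),
        (Φ f : H →L[ℂ] H) = fcZero T f ∧ fc T f.toContinuousMap = ofBounded (Φ f : H →L[ℂ] H)) ∧
    -- the special cases `1(T) = I`, `id(T) = T` and `(id - z)⁻¹(T) = (T - z)⁻¹`
    fc T 1 = ofBounded (ContinuousLinearMap.id ℂ H) ∧
    fc T (idFun T) = T ∧
    ∀ (z : ℂ) (hz : z ∈ resolvSet T), fc T (resolventFun T z hz) = (subScalar T z).inverse := by
  refine ⟨fun f => ⟨fun h ψ => ?_, fcPre_domain hT f,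
      dense_domain_of_mem_graph hT (mem_fcPre_graph hT f),
      isClosable_of_graph_le hT (fcPre_graph_le hT f), fc_adjoint hT f⟩,
    fun f => ⟨fun h ψ => ?_, fcPreBounded_domain hT f,
      dense_domain_of_mem_graph hT (mem_fcPreBounded_graph_of_compactlySupported hT f),
      isClosable_of_graph_le hT (fcPreBounded_graph_le hT f), fcPreBounded_closure hT f⟩,
    fun f hf => ?_, ?_, fc_one hT, fc_idFun hT, fc_resolventFun hT⟩
  · obtain ⟨⟨x, hx⟩, rfl, hx'⟩ := (LinearPMap.mem_graph_iff _).1 (mem_fcPre_graph hT f h ψ)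
    exact ⟨hx, hx'⟩
  · obtain ⟨⟨x, hx⟩, rfl, hx'⟩ := (LinearPMap.mem_graph_iff _).1 (mem_fcPreBounded_graph hT f h ψ)
    exact ⟨hx, hx'⟩
  · have hstar : star f = f := by
      ext x
      exact Complex.conj_eq_iff_im.2 (hf x)
    refine ⟨LinearPMap.isSelfAdjoint_def.2 ?_, ?_⟩
    · rw [fc_adjoint hT, hstar]
    · rw [fcPre_adjoint hT, hstar, fc]
  · obtain ⟨Φ, hΦ, h⟩ := exists_starHom hT
    exact ⟨Φ, hΦ, fun f => ⟨h f, by rw [h f, fc_zeroAtInfty hT]⟩⟩
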